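/- **Theorem.** Let $\mathcal H$ be a finite dimensional real or complex inner product space, let $A:\mathcal H\to\mathcal H$ be a Hermitian linear operator, and let $\mathcal X,\mathcal Y$ be subspaces of $\mathcal H$ with $\dim\mathcal X=\dim\mathcal Y=n$. *Notation.* For a Hermitian operator $B$, $\Lambda(B)$ is the vector of its eigenvalues, repeated according to multiplicity and arranged in decreasing order. $P_{\mathcal Z}$ is the orthogonal projector onto $\mathcal Z$, and $\Lambda_{\mathcal Z}=\Lambda\big((P_{\mathcal Z}A)|_{\mathcal Z}\big)$ is the vector of Ritz values of $A$ with respect to $\mathcal Z$. The vector of principal angles $\Theta(\mathcal X,\mathcal Y)=[\theta_1\ge\dots\ge\theta_n]$, $\theta_i\in[0,\pi/2]$, is defined by letting $\cos^2\theta_1\le\dots\le\cos^2\theta_n$ be the eigenvalues of $(P_{\mathcal X}P_{\mathcal Y})|_{\mathcal X}$ in increasing order, counting multiplicities. The vector spread is $$\mathrm{Spr}_{(\mathcal X+\mathcal Y)}=\big[\lambda_i-\lambda_{-i},\ i=1,\dots,n\big],$$ where $\lambda_1\ge\dots\ge\lambda_n$ are the $n$ largest and $\lambda_{-1}\le\dots\le\lambda_{-n}$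 the $n$ smallest eigenvalues of $(P_{\mathcal X+\mathcal Y}A)|_{\mathcal X+\mathcal Y}$, counting multiplicities, and $\lambda_{\min(\mathcal X+\mathcal Y)}=\lambda_{-1}$. For $x,y\in\mathbb R^n$, $x\prec_w y$ means $\sum_{i=1}^k x_i^\downarrow\le\sum_{i=1}^k y_i^\downarrow$ for $k=1,\dots,n$, where $x^\downarrow$ is $x$ rearranged in decreasing order. Products, squares, sines, absolute values and inequalities $\le$ of vectors are componentwise, and a scalar also denotes the vector all of whose components equal it. *Claim.* Suppose that $\mathcal X$ is $A$-invariant and corresponds to the contiguous set of the largest eigenvalues of $A$, i.e. the eigenvalues of $A|_{\mathcal X}$ are the $n$ largest eigenvalues of $A$, counting multiplicities. Then $$\big|\Lambda_{\mathcal X}-\Lambda_{\mathcal Y}\big|\ \prec_w\ \mathrm{Spr}_{(\mathcal X+\mathcal Y)}\,\sin^2\Theta(\mathcal X,\mathcal Y).$$ Moreover $\mathrm{Spr}_{(\mathcal X+\mathcal Y)}\le\Lambda_{\mathcal X}-\lambda_{\min(\mathcal X+\mathcal Y)}$, and $$0\ \le\ \Lambda_{\mathcal X}-\Lambda_{\mathcal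 Y}\ \prec_w\ \big(\Lambda_{\mathcal X}-\lambda_{\min(\mathcal X+\mathcal Y)}\big)\,\sin^2\Theta(\mathcal X,\mathcal Y).$$ -/

import Mathlib

namespace RayleighRitz

/-! ### Weak majorization -/

/-- The vector `x↓` obtained by rearranging the entries of `x` in decreasing order. -/
noncomputable def decreasing {n : ℕ} (x : Fin n → ℝ) : Fin n → ℝ :=
  x ∘ Tuple.sort (fun i => -x i)

theorem decreasing_antitone {n : ℕ} (x : Fin n → ℝ) : Antitone (decreasing x) := by
  intro i j hij
  have h := Tuple.monotone_sort (fun i => -x i) hij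
  simpa [decreasing] using h

/-- `x ≺_w y`: for every `k = 1, …, n`, the sum of the `k` largest entries of `x` is at most the
sum of the `k` largest entries of `y` (the case `k = 0` is trivial). -/
def WeaklyMajorizedBy {n : ℕ} (x y : Fin n → ℝ) : Prop :=
  ∀ k : ℕ, k ≤ n →
    ∑ i : Fin n with i.val < k, decreasing x i ≤ ∑ i : Fin n with i.val < k, decreasing y i

/-! ### Ritz values -/

section

variable {𝕜 E : Type*} [RCLike 𝕜] [NormedAddCommGroup E] [InnerProductSpace 𝕜 E]
  [FiniteDimensional 𝕜 E]

/-- The Rayleigh-Ritz operator `(P_X A)|_X : X → X`. -/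
noncomputable def rayleighRitz (A : E →ₗ[𝕜] E) (X : Submodule 𝕜 E) : X →ₗ[𝕜] X :=
  X.orthogonalProjectionOnto.toLinearMap ∘ₗ A ∘ₗ X.subtype

theorem rayleighRitz_isSymmetric {A : E →ₗ[𝕜] E} (hA : A.IsSymmetric) (X : Submodule 𝕜 E) :
    (rayleighRitz A X).IsSymmetric := by
  intro x y
  simp only [rayleighRitz, LinearMap.comp_apply, Submodule.subtype_apply,
    ContinuousLinearMap.coe_coe, Submodule.inner_orthogonalProjectionOnto_eq_of_mem_right,
    Submodule.inner_orthogonalProjectionOnto_eq_of_mem_left]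
  exact hA x y

/-- The vector `Λ((P_X A)|_X)` of Ritz values of `A` with respect to `X`, in decreasing order and
repeated according to multiplicity. -/
noncomputable def ritzValues {A : E →ₗ[𝕜] E} (hA : A.IsSymmetric) (X : Submodule 𝕜 E) {n : ℕ}
    (hX : Module.finrank 𝕜 X = n) : Fin n → ℝ :=
  (rayleighRitz_isSymmetric hA X).eigenvalues hX

/-- The smallest Ritz value of `A` with respect to `X` (meaningful for `X ≠ 0`). -/
noncomputable def ritzMin {A : E →ₗ[𝕜] E} (hA : A.IsSymmetric) (X : Submodule 𝕜 E) : ℝ :=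
  ⨅ i, ritzValues hA X rfl i

/-- `X` is `A`-invariant and corresponds to the contiguous set of the largest eigenvalues of `A`:
the eigenvalues of the restriction of `A` to `X` are the `dim X` largest eigenvalues of `A`,
counting multiplicities. -/
def IsInvariantForLargest {A : E →ₗ[𝕜] E} (hA : A.IsSymmetric) (X : Submodule 𝕜 E) : Prop :=
  ∃ hinv : ∀ x ∈ X, A x ∈ X, ∀ i : Fin (Module.finrank 𝕜 X),
    (hA.restrict_invariant hinv).eigenvalues rfl i =
      hA.eigenvalues rfl (Fin.castLE (Submodule.finrank_le X) i)

/-! ### Principal angles -/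

/-- The vector `cos² Θ(X, Y)`: the eigenvalues of `(P_X P_Y)|_X` in increasing order. -/
noncomputable def cosSqAngles (X Y : Submodule 𝕜 E) {n : ℕ} (hX : Module.finrank 𝕜 X = n) :
    Fin n → ℝ :=
  fun i => ritzValues (A := Y.starProjection.toLinearMap) Y.starProjection_isSymmetric X hX i.rev

/-- The vector `Θ(X, Y)` of principal angles from `X` to `Y`, in decreasing order, with entries
in `[0, π/2]`. -/
noncomputable def principalAngles (X Y : Submodule 𝕜 E) {n : ℕ} (hX : Module.finrank 𝕜 X = n) :
    Fin n → ℝ :=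
  fun i => Real.arccos (Real.sqrt (cosSqAngles X Y hX i))

/-! ### The vector spread -/

/-- The vector spread `Spr_{X+Y}`: its `i`-th entry, `i = 1, …, dim X`, is the `i`-th largest minus
the `i`-th smallest Ritz value of `A` with respect to `X + Y`, counting multiplicities. -/
noncomputable def vectorSpread {A : E →ₗ[𝕜] E} (hA : A.IsSymmetric) (X Y : Submodule 𝕜 E) {n : ℕ}
    (hX : Module.finrank 𝕜 X = n) : Fin n → ℝ :=
  have h : n ≤ Module.finrank 𝕜 ↥(X ⊔ Y) := hX ▸ Submodule.finrank_mono le_sup_left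
  fun i => ritzValues hA (X ⊔ Y) rfl (Fin.castLE h i) -
    ritzValues hA (X ⊔ Y) rfl (Fin.castLE h i).rev

end

end RayleighRitz

/-!
Let `λ₁ ≥ ⋯ ≥ λₙ` be the eigenvalues of `A` on the invariant subspace `X`, put `μ = λₙ`, and let `G`
be the orthogonal complement of `X` in `X + Y`. Since `X` carries the largest eigenvalues, `A - μ` is
positive semidefinite on `X` and negative semidefinite on `G`. Write `D = (A - μ)|_X` and
`F = μ - (P_G A)|_G`. Splitting `y ∈ Y` into `P_X y` and `K y = y - P_X y ∈ G` gives
`(P_Y A)|_Y - μ = L D L* - K* F K`, where `L = P_Y|_X`.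

The operator `L D L*` on `Y` has the same eigenvalues as `√D B √D = D - √D (1 - B) √D` on `X`, where
`B = L* L = (P_X P_Y)|_X`; the eigenvalues of `1 - B` are the numbers `sin² θᵢ`. Lidskii's inequality
(`sum_eigenvalues_sub_le`) therefore bounds the sum of `k` components of `Λ_X - Λ_Y` by the sum of the
`k` largest eigenvalues of `√D (1 - B) √D` plus the sum of those of `K* F K`. The multiplicative
inequality `sum_eigenvalues_le_sum_mul` bounds these sums by `∑ λᵢ(D) sin² θᵢ` and `∑ λᵢ(F) sin² θᵢ`.
As `λᵢ(D) = λᵢ - μ` and, by interlacing, `λᵢ(F) ≤ μ - λ₋ᵢ`, the two bounds add up to the spread times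
`sin² θᵢ`, and `μ` disappears. The remaining claims follow from Cauchy interlacing, which is also why
the absolute values in the first claim can be dropped.
-/

namespace RayleighRitz

open scoped InnerProductSpace
open Module (finrank)

section Operators

variable {𝕜 V W G : Type*} [RCLike 𝕜] [NormedAddCommGroup V] [InnerProductSpace 𝕜 V]
  [NormedAddCommGroup W] [InnerProductSpace 𝕜 W]
  [NormedAddCommGroup G] [InnerProductSpace 𝕜 G]

/-! ### Quadratic forms in an eigenbasis -/

theorem apply_eq_sum_of_basis {ι : Type*} [Fintype ι] {T : V →ₗ[𝕜] V}
    (b : OrthonormalBasis ι 𝕜 V) {d : ι → ℝ} (hb : ∀ i, T (b i) = (d i : 𝕜) • b i) (x : V) :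
    T x = ∑ i, ⟪b i, x⟫_𝕜 • (d i : 𝕜) • b i := by
  conv_lhs => rw [← b.sum_repr' x]
  simp [hb]

theorem re_inner_apply_self_of_basis {ι : Type*} [Fintype ι] {T : V →ₗ[𝕜] V}
    (b : OrthonormalBasis ι 𝕜 V) (d : ι → ℝ) (hb : ∀ i, T (b i) = (d i : 𝕜) • b i) (x : V) :
    RCLike.re ⟪T x, x⟫_𝕜 = ∑ i, d i * ‖⟪b i, x⟫_𝕜‖ ^ 2 := by
  rw [apply_eq_sum_of_basis b hb, sum_inner, map_sum]
  refine Finset.sum_congr rfl fun i _ => ?_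
  rw [inner_smul_left, inner_smul_left, RCLike.conj_ofReal, mul_left_comm, RCLike.conj_mul]
  norm_cast

/-- Vectors supported on the coordinates in `s` form a subspace of dimension `#s`. -/
theorem exists_span_finset {ι : Type*} [Fintype ι] (b : OrthonormalBasis ι 𝕜 V) (s : Finset ι) :
    ∃ U : Submodule 𝕜 V, finrank 𝕜 U = s.card ∧ ∀ x ∈ U, ∀ i ∉ s, ⟪b i, x⟫_𝕜 = 0 := by
  classical
  refine ⟨Submodule.span 𝕜 (Set.range fun i : s => b i), ?_, fun x hx i hi => ?_⟩
  · have hli : LinearIndependent 𝕜 fun i : s => b i :=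
      (b.orthonormal.comp _ Subtype.val_injective).linearIndependent
    rw [finrank_span_eq_card hli, Fintype.card_coe]
  · induction hx using Submodule.span_induction with
    | mem y hy =>
      obtain ⟨j, rfl⟩ := hy
      exact b.orthonormal.2 fun h => hi (h ▸ j.2)
    | zero => simp
    | add y z _ _ hy hz => rw [inner_add_right, hy, hz, add_zero]
    | smul a y _ hy => rw [inner_smul_right, hy, mul_zero]

theorem sum_mul_sq_le {ι : Type*} [Fintype ι] (b : OrthonormalBasis ι 𝕜 V) (s : Finset ι)
    (d : ι → ℝ) (c : ℝ) (hd : ∀ i ∈ s, d i ≤ c) {x : V} (hx : ∀ i ∉ s, ⟪b i, x⟫_𝕜 = 0) :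
    ∑ i, d i * ‖⟪b i, x⟫_𝕜‖ ^ 2 ≤ c * ‖x‖ ^ 2 := by
  rw [← b.sum_sq_norm_inner_right x, Finset.mul_sum]
  refine Finset.sum_le_sum fun i _ => ?_
  by_cases hi : i ∈ s
  · exact mul_le_mul_of_nonneg_right (hd i hi) (by positivity)
  · simp [hx i hi]

theorem mul_sq_le_sum {ι : Type*} [Fintype ι] (b : OrthonormalBasis ι 𝕜 V) (s : Finset ι)
    (d : ι → ℝ) (c : ℝ) (hd : ∀ i ∈ s, c ≤ d i) {x : V} (hx : ∀ i ∉ s, ⟪b i, x⟫_𝕜 = 0) :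
    c * ‖x‖ ^ 2 ≤ ∑ i, d i * ‖⟪b i, x⟫_𝕜‖ ^ 2 := by
  have := sum_mul_sq_le b s (fun i => - d i) (-c) (fun i hi => neg_le_neg (hd i hi)) hx
  simp only [neg_mul, Finset.sum_neg_distrib] at this
  linarith

theorem exists_diagonal {ι : Type*} [Fintype ι] (b : OrthonormalBasis ι 𝕜 V) (f : ι → ℝ) :
    ∃ S : V →ₗ[𝕜] V, S.IsSymmetric ∧ ∀ i, S (b i) = (f i : 𝕜) • b i := by
  classical
  have hS : ∀ i, b.toBasis.constr 𝕜 (fun i => (f i : 𝕜) • b i) (b i) = (f i : 𝕜) • b i :=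
    fun i => by
      conv_lhs => rw [← b.coe_toBasis, Module.Basis.constr_basis]
      simp
  refine ⟨b.toBasis.constr 𝕜 fun i => (f i : 𝕜) • b i, fun x y => ?_, hS⟩
  rw [apply_eq_sum_of_basis b hS x, apply_eq_sum_of_basis b hS y, sum_inner, inner_sum]
  refine Finset.sum_congr rfl fun i _ => ?_
  simp only [inner_smul_left, inner_smul_right, RCLike.conj_ofReal, inner_conj_symm]
  ring

variable [FiniteDimensional 𝕜 V]

theorem re_inner_apply_self {n : ℕ} {T : V →ₗ[𝕜] V} (hT : T.IsSymmetric)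
    (hn : finrank 𝕜 V = n) (x : V) :
    RCLike.re ⟪T x, x⟫_𝕜 =
      ∑ i, hT.eigenvalues hn i * ‖⟪hT.eigenvectorBasis hn i, x⟫_𝕜‖ ^ 2 :=
  re_inner_apply_self_of_basis _ _ (hT.apply_eigenvectorBasis hn) x

/-! ### Courant-Fischer comparison of eigenvalues -/

theorem exists_ne_zero_mem_inf {U U' : Submodule 𝕜 V}
    (h : finrank 𝕜 V < finrank 𝕜 U + finrank 𝕜 U') : ∃ x ∈ U, x ∈ U' ∧ x ≠ 0 := by
  have h1 := Submodule.finrank_sup_add_finrank_inf_eq U U'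
  have h2 := Submodule.finrank_le (U ⊔ U')
  have h3 : U ⊓ U' ≠ ⊥ := by
    intro h0
    rw [h0, finrank_bot] at h1
    omega
  obtain ⟨x, hx, hx0⟩ := Submodule.exists_mem_ne_zero_of_ne_bot h3
  exact ⟨x, hx.1, hx.2, hx0⟩

/-- The Courant-Fischer comparison: if the quadratic form of `T'`, carried along the isometry `J`, is at
most that of `T` plus `c`, then the `i`-th largest eigenvalue of `T'` is at most that of `T` plus `c`.
The span of the first `i + 1` eigenvectors of `T'` must meet the span of the eigenvectors of `T` of
index at least `i`. It is stated for arbitrary sorted eigenbases, so that it also shows that the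
sorted vector of eigenvalues does not depend on the eigenbasis. -/
theorem le_eigenvalues_of_basis {n m : ℕ} {T : V →ₗ[𝕜] V}
    {T' : W →ₗ[𝕜] W} (b : OrthonormalBasis (Fin n) 𝕜 V) (d : Fin n → ℝ) (hd : Antitone d)
    (hb : ∀ i, T (b i) = (d i : 𝕜) • b i)
    (b' : OrthonormalBasis (Fin m) 𝕜 W) (d' : Fin m → ℝ) (hd' : Antitone d')
    (hb' : ∀ i, T' (b' i) = (d' i : 𝕜) • b' i)
    (J : W →ₗᵢ[𝕜] V) (c : ℝ)
    (h : ∀ x, RCLike.re ⟪T' x, x⟫_𝕜 ≤ RCLike.re ⟪T (J x), J x⟫_𝕜 + c * ‖x‖ ^ 2)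
    (i : Fin m) (j : Fin n) (hij : (i : ℕ) = j) : d' i ≤ d j + c := by
  obtain ⟨U', hU'f, hU'⟩ := exists_span_finset b' (Finset.Iic i)
  obtain ⟨U, hUf, hU⟩ := exists_span_finset b (Finset.Ici j)
  have hn : finrank 𝕜 V = n := by simpa using Module.finrank_eq_card_basis b.toBasis
  have hmap : finrank 𝕜 (U'.map J.toLinearMap) = finrank 𝕜 U' :=
    (Submodule.equivMapOfInjective _ J.injective U').finrank_eq.symm
  obtain ⟨x, hx, hxU, hx0⟩ : ∃ x ∈ U'.map J.toLinearMap, x ∈ U ∧ x ≠ 0 := by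
    refine exists_ne_zero_mem_inf ?_
    rw [hmap, hU'f, hUf, hn, Fin.card_Iic, Fin.card_Ici]
    omega
  obtain ⟨y, hy, rfl⟩ := hx
  have hyn : 0 < ‖y‖ ^ 2 := by
    have : y ≠ 0 := fun h => hx0 (by rw [h, map_zero])
    positivity
  have h1 := mul_sq_le_sum b' (Finset.Iic i) d' (d' i)
    (fun k hk => hd' (Finset.mem_Iic.1 hk)) (hU' y hy)
  have h2 := sum_mul_sq_le b (Finset.Ici j) d (d j)
    (fun k hk => hd (Finset.mem_Ici.1 hk)) (hU _ hxU)
  rw [← re_inner_apply_self_of_basis b' d' hb'] at h1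
  rw [← re_inner_apply_self_of_basis b d hb] at h2
  have h3 := h y
  have h4 : ‖J.toLinearMap y‖ = ‖y‖ := J.norm_map y
  rw [h4] at h2
  have : d' i * ‖y‖ ^ 2 ≤ (d j + c) * ‖y‖ ^ 2 := by
    rw [add_mul]; exact h1.trans (h3.trans (add_le_add_left h2 _))
  exact le_of_mul_le_mul_right this hyn

variable [FiniteDimensional 𝕜 W]

theorem eigenvalues_le_eigenvalues_add {n m : ℕ} {T : V →ₗ[𝕜] V} (hT : T.IsSymmetric)
    (hn : finrank 𝕜 V = n) {T' : W →ₗ[𝕜] W} (hT' : T'.IsSymmetric) (hm : finrank 𝕜 W = m)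
    (J : W →ₗᵢ[𝕜] V) (c : ℝ)
    (h : ∀ x, RCLike.re ⟪T' x, x⟫_𝕜 ≤ RCLike.re ⟪T (J x), J x⟫_𝕜 + c * ‖x‖ ^ 2)
    (i : Fin m) (j : Fin n) (hij : (i : ℕ) = j) :
    hT'.eigenvalues hm i ≤ hT.eigenvalues hn j + c :=
  le_eigenvalues_of_basis _ _ (hT.eigenvalues_antitone hn) (hT.apply_eigenvectorBasis hn) _ _
    (hT'.eigenvalues_antitone hm) (hT'.apply_eigenvectorBasis hm) J c h i j hij

/-- Monotonicity of eigenvalues (`J = id`) and Cauchy interlacing (`J` the inclusion of a subspace and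
`T'` the compression of `T`) in one statement. -/
theorem eigenvalues_le_eigenvalues {n m : ℕ} {T : V →ₗ[𝕜] V} (hT : T.IsSymmetric)
    (hn : finrank 𝕜 V = n) {T' : W →ₗ[𝕜] W} (hT' : T'.IsSymmetric) (hm : finrank 𝕜 W = m)
    (J : W →ₗᵢ[𝕜] V)
    (h : ∀ x, RCLike.re ⟪T' x, x⟫_𝕜 ≤ RCLike.re ⟪T (J x), J x⟫_𝕜)
    (i : Fin m) (j : Fin n) (hij : (i : ℕ) = j) :
    hT'.eigenvalues hm i ≤ hT.eigenvalues hn j := by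
  simpa using eigenvalues_le_eigenvalues_add hT hn hT' hm J 0 (by simpa using h) i j hij

theorem eigenvalues_mono {n : ℕ} {T S : V →ₗ[𝕜] V} (hT : T.IsSymmetric) (hS : S.IsSymmetric)
    (hn : finrank 𝕜 V = n) (h : ∀ x, RCLike.re ⟪T x, x⟫_𝕜 ≤ RCLike.re ⟪S x, x⟫_𝕜) (i : Fin n) :
    hT.eigenvalues hn i ≤ hS.eigenvalues hn i :=
  eigenvalues_le_eigenvalues hS hn hT hn LinearIsometry.id (by simpa using h) i i rfl

theorem eigenvalues_eq_of_basis {n : ℕ} {T : V →ₗ[𝕜] V} (hT : T.IsSymmetric)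
    (hn : finrank 𝕜 V = n) (b : OrthonormalBasis (Fin n) 𝕜 V) {d : Fin n → ℝ} (hd : Antitone d)
    (hb : ∀ i, T (b i) = (d i : 𝕜) • b i) : hT.eigenvalues hn = d := by
  funext i
  apply le_antisymm
  · simpa using le_eigenvalues_of_basis b d hd hb _ _ (hT.eigenvalues_antitone hn)
      (hT.apply_eigenvectorBasis hn) LinearIsometry.id 0 (by simp) i i rfl
  · simpa using le_eigenvalues_of_basis _ _ (hT.eigenvalues_antitone hn)
      (hT.apply_eigenvectorBasis hn) b d hd hb LinearIsometry.id 0 (by simp) i i rfl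

theorem eigenvalues_sub_const {n : ℕ} {T S : V →ₗ[𝕜] V} (hT : T.IsSymmetric) (hS : S.IsSymmetric)
    (hn : finrank 𝕜 V = n) (c : ℝ) (h : ∀ x, S x = T x - (c : 𝕜) • x) (i : Fin n) :
    hS.eigenvalues hn i = hT.eigenvalues hn i - c := by
  rw [eigenvalues_eq_of_basis hS hn (hT.eigenvectorBasis hn)
    (d := fun i => hT.eigenvalues hn i - c)]
  · exact fun i j hij => sub_le_sub_right (hT.eigenvalues_antitone hn hij) c
  · intro i
    rw [h, hT.apply_eigenvectorBasis, RCLike.ofReal_sub, sub_smul]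

theorem eigenvalues_const_sub {n : ℕ} {T S : V →ₗ[𝕜] V} (hT : T.IsSymmetric) (hS : S.IsSymmetric)
    (hn : finrank 𝕜 V = n) (c : ℝ) (h : ∀ x, S x = (c : 𝕜) • x - T x) (i : Fin n) :
    hS.eigenvalues hn i = c - hT.eigenvalues hn i.rev := by
  rw [eigenvalues_eq_of_basis hS hn ((hT.eigenvectorBasis hn).reindex Fin.revPerm)
    (d := fun i => c - hT.eigenvalues hn i.rev)]
  · exact fun i j hij => sub_le_sub_left (hT.eigenvalues_antitone hn (Fin.rev_le_rev.2 hij)) c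
  · intro i
    simp [h, hT.apply_eigenvectorBasis, sub_smul]

/-! ### Trace, square roots and Ky Fan's principle -/

theorem eigenvalues_nonneg {n : ℕ} {T : V →ₗ[𝕜] V} (hT : T.IsSymmetric) (hn : finrank 𝕜 V = n)
    (h : ∀ x, 0 ≤ RCLike.re ⟪T x, x⟫_𝕜) (i : Fin n) : 0 ≤ hT.eigenvalues hn i := by
  have := h (hT.eigenvectorBasis hn i)
  rw [hT.apply_eigenvectorBasis, inner_smul_left] at this
  simpa using this

theorem sum_eigenvalues_eq {n : ℕ} {ι : Type*} [Fintype ι] {T : V →ₗ[𝕜] V} (hT : T.IsSymmetric)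
    (hn : finrank 𝕜 V = n) (b : OrthonormalBasis ι 𝕜 V) :
    ∑ i, hT.eigenvalues hn i = ∑ i, RCLike.re ⟪T (b i), b i⟫_𝕜 := by
  subst hn
  rw [← hT.re_trace_eq_sum_eigenvalues, LinearMap.trace_eq_sum_inner T b, map_sum]
  exact Finset.sum_congr rfl fun i _ => by rw [← hT]

theorem exists_sqrt {T : V →ₗ[𝕜] V} (hT : T.IsSymmetric)
    (h : ∀ x, 0 ≤ RCLike.re ⟪T x, x⟫_𝕜) :
    ∃ S : V →ₗ[𝕜] V, S.IsSymmetric ∧ S ∘ₗ S = T := by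
  obtain ⟨S, hS, hSb⟩ := exists_diagonal (hT.eigenvectorBasis rfl)
    fun i => √(hT.eigenvalues rfl i)
  refine ⟨S, hS, (hT.eigenvectorBasis rfl).toBasis.ext fun i => ?_⟩
  simp only [OrthonormalBasis.coe_toBasis, LinearMap.comp_apply, hSb, map_smul,
    hT.apply_eigenvectorBasis, smul_smul]
  rw [← RCLike.ofReal_mul, Real.mul_self_sqrt (eigenvalues_nonneg hT rfl h i)]

/-- `L M` and `M L` have the same characteristic polynomial, hence the same sorted eigenvalues. -/
theorem eigenvalues_comp_comm {n : ℕ} (hV : finrank 𝕜 V = n) (hW : finrank 𝕜 W = n)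
    (L : V →ₗ[𝕜] W) (M : W →ₗ[𝕜] V) (h1 : (M ∘ₗ L).IsSymmetric) (h2 : (L ∘ₗ M).IsSymmetric) :
    h1.eigenvalues hV = h2.eigenvalues hW := by
  rw [LinearMap.IsSymmetric.eigenvalues_eq_eigenvalues_iff]
  have b := Module.finBasisOfFinrankEq 𝕜 V hV
  have b' := Module.finBasisOfFinrankEq 𝕜 W hW
  rw [← LinearMap.charpoly_toMatrix _ b, ← LinearMap.charpoly_toMatrix _ b',
    LinearMap.toMatrix_comp b b' b, LinearMap.toMatrix_comp b' b b', Matrix.charpoly_mul_comm]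

theorem sum_castLE_eq {n k : ℕ} (h : k ≤ n) (f : Fin n → ℝ) :
    ∑ i : Fin k, f (Fin.castLE h i) = ∑ i : Fin n with i.val < k, f i := by
  refine Finset.sum_bij (fun i _ => Fin.castLE h i) (by simp)
    (fun i _ j _ hij => Fin.castLE_injective h hij) (fun j hj => ?_) (by simp)
  exact ⟨⟨j, (Finset.mem_filter.1 hj).2⟩, Finset.mem_univ _, rfl⟩

theorem card_filter_val_lt {n k : ℕ} (h : k ≤ n) :
    (Finset.univ.filter fun i : Fin n => i.val < k).card = k := by
  have := sum_castLE_eq h (fun _ => 1)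
  simp only [Finset.sum_const, Finset.card_univ, Fintype.card_fin, nsmul_eq_mul, mul_one] at this
  exact_mod_cast this.symm

/-- The sum of the `k` largest entries `e₀ ≥ ⋯ ≥ eₖ₋₁` of a decreasing vector, written through the
positive parts `(eᵢ - eₖ₋₁)⁺`. The point is that the latter sum does not depend on the order of the
entries and bounds every partial sum. -/
theorem sum_max_sub_add_eq {n k : ℕ} (hk : 0 < k) (hkn : k ≤ n) {e : Fin n → ℝ}
    (he : Antitone e) :
    ∑ i, max (e i - e ⟨k - 1, by omega⟩) 0 + k * e ⟨k - 1, by omega⟩ =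
      ∑ i : Fin n with i.val < k, e i := by
  have h : ∑ i, max (e i - e ⟨k - 1, by omega⟩) 0 =
      ∑ i : Fin n with i.val < k, (e i - e ⟨k - 1, by omega⟩) := by
    rw [Finset.sum_filter]
    refine Finset.sum_congr rfl fun i _ => ?_
    split_ifs with hi
    · exact max_eq_left (sub_nonneg.2 (he (Fin.le_def.2 (by simp only; omega))))
    · exact max_eq_right (sub_nonpos.2 (he (Fin.le_def.2 (by simp only; omega))))
  rw [h, Finset.sum_sub_distrib, Finset.sum_const, card_filter_val_lt hkn, nsmul_eq_mul,
    sub_add_cancel]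

/-- Ky Fan's maximum principle, from interlacing for the compression of `T` to the span of `u`. -/
theorem sum_inner_le_sum_eigenvalues {n k : ℕ} {T : V →ₗ[𝕜] V} (hT : T.IsSymmetric)
    (hn : finrank 𝕜 V = n) {u : Fin k → V} (hu : Orthonormal 𝕜 u) :
    ∑ l, RCLike.re ⟪T (u l), u l⟫_𝕜 ≤ ∑ i : Fin n with i.val < k, hT.eigenvalues hn i := by
  have hk : k ≤ n := by
    simpa only [hn, Fintype.card_fin] using hu.linearIndependent.fintype_card_le_finrank
  let b := EuclideanSpace.basisFun (Fin k) 𝕜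
  let J₀ : EuclideanSpace 𝕜 (Fin k) →ₗ[𝕜] V := b.toBasis.constr 𝕜 u
  have hJ₀ : ∀ i, J₀ (b i) = u i := fun i => by
    rw [← b.coe_toBasis]
    exact Module.Basis.constr_basis _ _ _ _
  let J : EuclideanSpace 𝕜 (Fin k) →ₗᵢ[𝕜] V := J₀.isometryOfOrthonormal (v := b.toBasis)
    (by rw [b.coe_toBasis]; exact b.orthonormal) (by convert hu; funext i; simp [hJ₀])
  have hJ : ∀ i, J (b i) = u i := hJ₀
  let T' := J.toLinearMap.adjoint ∘ₗ T ∘ₗ J.toLinearMap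
  have hq : ∀ x y, ⟪T' x, y⟫_𝕜 = ⟪T (J x), J y⟫_𝕜 := fun x y => by
    simp [T', LinearMap.adjoint_inner_left]
  have hT' : T'.IsSymmetric := fun x y => by
    rw [hq, hT, ← inner_conj_symm x, hq, inner_conj_symm]
  have hf : finrank 𝕜 (EuclideanSpace 𝕜 (Fin k)) = k := finrank_euclideanSpace_fin
  calc ∑ l, RCLike.re ⟪T (u l), u l⟫_𝕜 = ∑ i, hT'.eigenvalues hf i := by
        rw [sum_eigenvalues_eq hT' hf b]
        simp only [hq, hJ]
    _ ≤ ∑ i : Fin k, hT.eigenvalues hn (Fin.castLE hk i) :=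
        Finset.sum_le_sum fun i _ =>
          eigenvalues_le_eigenvalues hT hn hT' hf J (fun x => (congrArg _ (hq x x)).le) i _ rfl
    _ = _ := sum_castLE_eq hk _

theorem eigenvalues_one {n : ℕ} (h : (1 : V →ₗ[𝕜] V).IsSymmetric) (hn : finrank 𝕜 V = n)
    (i : Fin n) : h.eigenvalues hn i = 1 := by
  rw [eigenvalues_eq_of_basis h hn (h.eigenvectorBasis hn) (d := fun _ => 1) antitone_const
    fun i => by rw [Module.End.one_apply, RCLike.ofReal_one, one_smul]]

/-! ### Lidskii's inequality -/

/-- Lidskii's inequality, by the argument of Li and Mathias. With `k = #J` and `c` the `k`-th largest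
eigenvalue of `E`, one has `E ≤ (E - c)⁺ + c`. Replacing `E` by `(E - c)⁺` costs `k c`; adding the
positive operator `(E - c)⁺` raises every eigenvalue, so the sum over `J` is at most the sum over all
indices, which is the trace of `(E - c)⁺`. -/
theorem sum_eigenvalues_sub_le {n : ℕ} {T S E : V →ₗ[𝕜] V} (hT : T.IsSymmetric)
    (hS : S.IsSymmetric) (hE : E.IsSymmetric) (hn : finrank 𝕜 V = n)
    (h : ∀ x, RCLike.re ⟪T x, x⟫_𝕜 ≤ RCLike.re ⟪S x, x⟫_𝕜 + RCLike.re ⟪E x, x⟫_𝕜)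
    (J : Finset (Fin n)) :
    ∑ i ∈ J, (hT.eigenvalues hn i - hS.eigenvalues hn i) ≤
      ∑ i : Fin n with i.val < J.card, hE.eigenvalues hn i := by
  rcases J.eq_empty_or_nonempty with rfl | hJ
  · simp
  have hk : 0 < J.card := hJ.card_pos
  have hkn : J.card ≤ n := by simpa using J.card_le_univ
  generalize hkJ : J.card = k at *
  let e := hE.eigenvalues hn
  let b := hE.eigenvectorBasis hn
  let c : ℝ := e ⟨k - 1, by omega⟩
  obtain ⟨P, hP, hPb⟩ := exists_diagonal b fun i => max (e i - c) 0
  have hSP : (S + P).IsSymmetric := hS.add hP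
  have hPnn : ∀ x, 0 ≤ RCLike.re ⟪P x, x⟫_𝕜 := fun x => by
    rw [re_inner_apply_self_of_basis b _ hPb]
    exact Finset.sum_nonneg fun i _ => mul_nonneg (le_max_right _ _) (by positivity)
  have hEP : ∀ x, RCLike.re ⟪E x, x⟫_𝕜 ≤ RCLike.re ⟪P x, x⟫_𝕜 + c * ‖x‖ ^ 2 := fun x => by
    rw [re_inner_apply_self_of_basis b _ hPb, re_inner_apply_self hE hn,
      ← b.sum_sq_norm_inner_right x, Finset.mul_sum, ← Finset.sum_add_distrib]
    refine Finset.sum_le_sum fun i _ => ?_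
    rw [← add_mul]
    refine mul_le_mul_of_nonneg_right ?_ (by positivity)
    have : e i - c ≤ max (e i - c) 0 := le_max_left _ _
    change e i ≤ _
    linarith
  have h1 : ∀ i, hT.eigenvalues hn i ≤ hSP.eigenvalues hn i + c := fun i =>
    eigenvalues_le_eigenvalues_add hSP hn hT hn LinearIsometry.id c (fun x => by
      have := h x
      have := hEP x
      simp only [LinearIsometry.id_apply, LinearMap.add_apply, inner_add_left, map_add]
      linarith) i i rfl
  have h2 : ∀ i, hS.eigenvalues hn i ≤ hSP.eigenvalues hn i := fun i =>
    eigenvalues_mono hS hSP hn (fun x => by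
      have := hPnn x
      simp only [LinearMap.add_apply, inner_add_left, map_add]
      linarith) i
  have h3 : ∑ i, (hSP.eigenvalues hn i - hS.eigenvalues hn i) = ∑ i, max (e i - c) 0 := by
    rw [Finset.sum_sub_distrib, sum_eigenvalues_eq hSP hn b, sum_eigenvalues_eq hS hn b,
      ← Finset.sum_sub_distrib]
    refine Finset.sum_congr rfl fun i _ => ?_
    simp [inner_add_left, hPb, inner_smul_left, b.norm_eq_one]
  calc ∑ i ∈ J, (hT.eigenvalues hn i - hS.eigenvalues hn i)
      ≤ ∑ i ∈ J, ((hSP.eigenvalues hn i - hS.eigenvalues hn i) + c) :=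
        Finset.sum_le_sum fun i _ => by linarith [h1 i]
    _ = ∑ i ∈ J, (hSP.eigenvalues hn i - hS.eigenvalues hn i) + k * c := by
        rw [Finset.sum_add_distrib, Finset.sum_const, hkJ, nsmul_eq_mul]
    _ ≤ ∑ i, (hSP.eigenvalues hn i - hS.eigenvalues hn i) + k * c := by
        gcongr
        · exact fun i _ _ => sub_nonneg.2 (h2 i)
        · exact J.subset_univ
    _ = ∑ i : Fin n with i.val < k, e i := by
        rw [h3]
        exact sum_max_sub_add_eq hk hkn (hE.eigenvalues_antitone hn)

/-! ### Multiplicative majorization -/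

/-- Summation by parts: decreasing nonnegative weights preserve inequalities between partial sums. -/
theorem sum_mul_le_sum_mul_of_partial_sums {n : ℕ} {d a t : Fin n → ℝ} (hd : Antitone d)
    (hd0 : ∀ i, 0 ≤ d i)
    (h : ∀ j ≤ n, ∑ i : Fin n with i.val < j, a i ≤ ∑ i : Fin n with i.val < j, t i) :
    ∑ i, d i * a i ≤ ∑ i, d i * t i := by
  induction n with
  | zero => simp
  | succ n ih =>
    have hs : ∀ (j : ℕ), j ≤ n → ∀ f : Fin (n + 1) → ℝ,
        ∑ i : Fin (n + 1) with i.val < j, f i = ∑ i : Fin n with i.val < j, f i.castSucc := by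
      intro j hj f
      rw [Finset.sum_filter, Fin.sum_univ_castSucc, Finset.sum_filter]
      simp [hj]
    have hall : ∑ i, a i ≤ ∑ i, t i := by
      have := h (n + 1) le_rfl
      rwa [Finset.filter_true_of_mem fun i _ => i.isLt] at this
    have ih' := ih (d := fun i => d i.castSucc - d (Fin.last n)) (a := fun i => a i.castSucc)
      (t := fun i => t i.castSucc)
      (fun i j hij => sub_le_sub_right (hd (Fin.castSucc_le_castSucc_iff.2 hij)) _)
      (fun i => sub_nonneg.2 (hd (Fin.le_last _)))
      (fun j hj => by rw [← hs j hj, ← hs j hj]; exact h j (by omega))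
    have hsplit : ∀ f : Fin (n + 1) → ℝ, ∑ i, d i * f i =
        ∑ i : Fin n, (d i.castSucc - d (Fin.last n)) * f i.castSucc +
          d (Fin.last n) * ∑ i, f i := by
      intro f
      rw [Fin.sum_univ_castSucc, Fin.sum_univ_castSucc f, mul_add, ← add_assoc, Finset.mul_sum,
        ← Finset.sum_add_distrib]
      congr 1
      exact Finset.sum_congr rfl fun i _ => by ring
    rw [hsplit, hsplit]
    exact add_le_add ih' (mul_le_mul_of_nonneg_left hall (hd0 _))

/-- The operator `R = ∑_{i < j} ⟨wᵢ, ·⟩ wᵢ` has trace `∑_{i < j} ‖wᵢ‖²`, satisfies `R ≤ T`, and has rank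
at most `j`, so only its first `j` eigenvalues contribute to the trace. -/
theorem sum_norm_sq_le_sum_eigenvalues {n : ℕ} {T : V →ₗ[𝕜] V} (hT : T.IsSymmetric)
    (hn : finrank 𝕜 V = n) (w : Fin n → V)
    (h : ∀ z, ∑ i, ‖⟪w i, z⟫_𝕜‖ ^ 2 ≤ RCLike.re ⟪T z, z⟫_𝕜) {j : ℕ} (hj : j ≤ n) :
    ∑ i : Fin n with i.val < j, ‖w i‖ ^ 2 ≤ ∑ i : Fin n with i.val < j, hT.eigenvalues hn i := by
  classical
  let s : Finset (Fin n) := Finset.univ.filter fun i => i.val < j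
  have hs : s.card = j := card_filter_val_lt hj
  let R : V →ₗ[𝕜] V := ∑ i ∈ s, (innerSL 𝕜 (w i)).toLinearMap.smulRight (w i)
  have hR : ∀ z, R z = ∑ i ∈ s, ⟪w i, z⟫_𝕜 • w i := fun z => by simp [R]
  have hRs : R.IsSymmetric := fun x y => by
    rw [hR, hR, sum_inner, inner_sum]
    refine Finset.sum_congr rfl fun i _ => ?_
    rw [inner_smul_left, inner_smul_right, inner_conj_symm, mul_comm]
  have hRq : ∀ z, RCLike.re ⟪R z, z⟫_𝕜 = ∑ i ∈ s, ‖⟪w i, z⟫_𝕜‖ ^ 2 := fun z => by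
    rw [hR, sum_inner, map_sum]
    refine Finset.sum_congr rfl fun i _ => ?_
    rw [inner_smul_left, RCLike.conj_mul]
    norm_cast
  have hRT : ∀ i, hRs.eigenvalues hn i ≤ hT.eigenvalues hn i := eigenvalues_mono hRs hT hn
    fun z => by
      rw [hRq]
      exact (Finset.sum_le_univ_sum_of_nonneg fun i => by positivity).trans (h z)
  -- Eigenvectors of positive eigenvalue lie in the span of the `j` vectors defining `R`.
  have hzero : ∀ i : Fin n, j ≤ i → hRs.eigenvalues hn i ≤ 0 := by
    intro i hi
    by_contra! hpos
    let b := hRs.eigenvectorBasis hn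
    have hli : LinearIndependent 𝕜 fun l : Finset.Iic i => b l :=
      (b.orthonormal.comp _ Subtype.val_injective).linearIndependent
    have hle : Submodule.span 𝕜 (Set.range fun l : Finset.Iic i => b l) ≤
        Submodule.span 𝕜 (s.image w : Set V) := by
      rw [Submodule.span_le]
      rintro _ ⟨l, rfl⟩
      have hl : (hRs.eigenvalues hn l : 𝕜) ≠ 0 := by
        have := hRs.eigenvalues_antitone hn (Finset.mem_Iic.1 l.2)
        exact_mod_cast (hpos.trans_le this).ne'
      have hb := hRs.apply_eigenvectorBasis hn l
      have hmem : R (b l) ∈ Submodule.span 𝕜 (s.image w : Set V) := by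
        rw [hR]
        exact Submodule.sum_mem _ fun m hm => Submodule.smul_mem _ _
          (Submodule.subset_span (Finset.mem_coe.2 (Finset.mem_image_of_mem w hm)))
      rw [hb] at hmem
      exact (Submodule.smul_mem_iff _ hl).1 hmem
    have h1 := Submodule.finrank_mono hle
    rw [finrank_span_eq_card hli, Fintype.card_coe, Fin.card_Iic] at h1
    have h2 := finrank_span_finset_le_card (R := 𝕜) (s.image w)
    have h3 := Finset.card_image_le (s := s) (f := w)
    rw [Set.finrank] at h2
    omega
  have htr : ∑ i ∈ s, ‖w i‖ ^ 2 = ∑ i, hRs.eigenvalues hn i := by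
    rw [sum_eigenvalues_eq hRs hn (hRs.eigenvectorBasis hn)]
    simp only [hRq]
    rw [Finset.sum_comm]
    exact Finset.sum_congr rfl fun i _ => ((hRs.eigenvectorBasis hn).sum_sq_norm_inner_left _).symm
  rw [htr, Finset.sum_filter]
  refine Finset.sum_le_sum fun i _ => ?_
  split_ifs with hi
  · exact hRT i
  · exact hzero i (by omega)

/-- The multiplicative majorization inequality: for `E ≤ K* D K`, where `D` is positive semidefinite with
decreasing eigenvalues `d` and eigenvectors `xᵢ`, and `K* K ≤ T`, the sum of the `k` largest
eigenvalues of `E` is at most `∑_{i < k} dᵢ λᵢ(T)`. The vectors `wᵢ` stand for `K* xᵢ`, so that `K`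
and its codomain need not appear, and missing eigenvectors can be replaced by `0`. -/
theorem sum_eigenvalues_le_sum_mul {n : ℕ} {T E : V →ₗ[𝕜] V} (hT : T.IsSymmetric)
    (hE : E.IsSymmetric) (hn : finrank 𝕜 V = n) (w : Fin n → V)
    (hw : ∀ z, ∑ i, ‖⟪w i, z⟫_𝕜‖ ^ 2 ≤ RCLike.re ⟪T z, z⟫_𝕜)
    {d : Fin n → ℝ} (hd : Antitone d) (hd0 : ∀ i, 0 ≤ d i)
    (hEw : ∀ z, RCLike.re ⟪E z, z⟫_𝕜 ≤ ∑ i, d i * ‖⟪w i, z⟫_𝕜‖ ^ 2) {k : ℕ} (hk : k ≤ n) :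
    ∑ i : Fin n with i.val < k, hE.eigenvalues hn i ≤
      ∑ i : Fin n with i.val < k, d i * hT.eigenvalues hn i := by
  let u : Fin k → V := fun l => hE.eigenvectorBasis hn (Fin.castLE hk l)
  have hu : Orthonormal 𝕜 u :=
    (hE.eigenvectorBasis hn).orthonormal.comp _ (Fin.castLE_injective hk)
  let a : Fin n → ℝ := fun i => ∑ l, ‖⟪w i, u l⟫_𝕜‖ ^ 2
  -- The partial sums of `a` are bounded in two ways: by `j` vectors `wᵢ`, and by `k` vectors `uₗ`.
  let t : Fin n → ℝ := fun i => if i.val < k then hT.eigenvalues hn i else 0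
  have ha : ∀ i, a i ≤ ‖w i‖ ^ 2 := fun i => by
    have := hu.sum_inner_products_le (w i) (s := Finset.univ)
    simpa only [a, norm_inner_symm (w i)] using this
  have ha_sum : ∑ i, a i ≤ ∑ i : Fin n with i.val < k, hT.eigenvalues hn i := by
    calc ∑ i, a i = ∑ l, ∑ i, ‖⟪w i, u l⟫_𝕜‖ ^ 2 := Finset.sum_comm
      _ ≤ ∑ l, RCLike.re ⟪T (u l), u l⟫_𝕜 := Finset.sum_le_sum fun l _ => hw _
      _ ≤ _ := sum_inner_le_sum_eigenvalues hT hn hu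
  have hpart : ∀ j ≤ n, ∑ i : Fin n with i.val < j, a i ≤ ∑ i : Fin n with i.val < j, t i := by
    intro j hj
    rcases le_total j k with hjk | hjk
    · calc ∑ i : Fin n with i.val < j, a i ≤ ∑ i : Fin n with i.val < j, ‖w i‖ ^ 2 :=
            Finset.sum_le_sum fun i _ => ha i
        _ ≤ _ := sum_norm_sq_le_sum_eigenvalues hT hn w hw hj
        _ = _ := Finset.sum_congr rfl fun i hi => by
            rw [Finset.mem_filter] at hi
            exact (if_pos (by omega)).symm
    · calc ∑ i : Fin n with i.val < j, a i ≤ ∑ i, a i :=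
            Finset.sum_le_univ_sum_of_nonneg fun i => Finset.sum_nonneg fun l _ => by positivity
        _ ≤ _ := ha_sum
        _ = ∑ i : Fin n with i.val < j, t i := by
            rw [Finset.sum_filter, Finset.sum_filter]
            refine Finset.sum_congr rfl fun i _ => ?_
            simp only [t]
            split_ifs <;> first | rfl | omega
  calc ∑ i : Fin n with i.val < k, hE.eigenvalues hn i
      = ∑ l, RCLike.re ⟪E (u l), u l⟫_𝕜 := by
        rw [← sum_castLE_eq hk]
        refine Finset.sum_congr rfl fun l _ => ?_
        simp [u, hE.apply_eigenvectorBasis, inner_smul_left]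
    _ ≤ ∑ l, ∑ i, d i * ‖⟪w i, u l⟫_𝕜‖ ^ 2 := Finset.sum_le_sum fun l _ => hEw _
    _ = ∑ i, d i * a i := by
        rw [Finset.sum_comm]
        exact Finset.sum_congr rfl fun i _ => (Finset.mul_sum _ _ _).symm
    _ ≤ ∑ i, d i * t i := sum_mul_le_sum_mul_of_partial_sums hd hd0 hpart
    _ = _ := by
        rw [Finset.sum_filter]
        refine Finset.sum_congr rfl fun i _ => ?_
        simp only [t, mul_ite, mul_zero]

/-! ### Comparison of two compressions -/

variable [FiniteDimensional 𝕜 G]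

/-- The operator form of the main inequality. Here `T ≥ L D L* - K* F K` with `D` and `F` positive
semidefinite and `L L* + K* K ≤ 1`. Since `L D L*` has the eigenvalues of
`√D B √D = D - √D (1 - B) √D` with `B = L* L`, Lidskii's inequality bounds the passage from `D` to
`L D L*` by the eigenvalues of `√D (1 - B) √D`, and the passage from `L D L*` to `T` by those of
`K* F K`. Both are controlled by products with the eigenvalues `1 - λ_{rev i}(B)` of `1 - B`. The
eigenvalues of `F` are padded with zeros up to length `n`. -/
theorem sum_eigenvalues_sub_le_sum_mul {n p : ℕ} (hV : finrank 𝕜 V = n) (hW : finrank 𝕜 W = n)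
    (hG : finrank 𝕜 G = p) (hp : p ≤ n)
    (L : V →ₗ[𝕜] W) (K : W →ₗ[𝕜] G) {D : V →ₗ[𝕜] V} (hD : D.IsSymmetric)
    (hD0 : ∀ x, 0 ≤ RCLike.re ⟪D x, x⟫_𝕜)
    {T : W →ₗ[𝕜] W} (hT : T.IsSymmetric) {F : G →ₗ[𝕜] G} (hF : F.IsSymmetric)
    (hF0 : ∀ x, 0 ≤ RCLike.re ⟪F x, x⟫_𝕜)
    {B : V →ₗ[𝕜] V} (hB : B.IsSymmetric) (hBL : B = L.adjoint ∘ₗ L) (hL : ∀ x, ‖L x‖ ≤ ‖x‖)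
    (hLK : ∀ y, ‖L.adjoint y‖ ^ 2 + ‖K y‖ ^ 2 ≤ ‖y‖ ^ 2)
    (hTq : ∀ y, RCLike.re ⟪D (L.adjoint y), L.adjoint y⟫_𝕜 ≤
      RCLike.re ⟪T y, y⟫_𝕜 + RCLike.re ⟪F (K y), K y⟫_𝕜)
    (J : Finset (Fin n)) :
    ∑ i ∈ J, (hD.eigenvalues hV i - hT.eigenvalues hW i) ≤
      ∑ i : Fin n with i.val < J.card,
        (hD.eigenvalues hV i + if h : i.val < p then hF.eigenvalues hG ⟨i, h⟩ else 0) *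
          (1 - hB.eigenvalues hV i.rev) := by
  have hk : J.card ≤ n := by simpa using J.card_le_univ
  have hBq : ∀ x, RCLike.re ⟪B x, x⟫_𝕜 = ‖L x‖ ^ 2 := fun x => by
    rw [hBL, LinearMap.comp_apply, LinearMap.adjoint_inner_left, inner_self_eq_norm_sq]
  have hone : (1 : V →ₗ[𝕜] V).IsSymmetric := LinearMap.IsSymmetric.id
  have hQ : (1 - B).IsSymmetric := hone.sub hB
  have hQq : ∀ x, RCLike.re ⟪(1 - B) x, x⟫_𝕜 = ‖x‖ ^ 2 - ‖L x‖ ^ 2 := fun x => by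
    rw [LinearMap.sub_apply, inner_sub_left, map_sub, hBq, Module.End.one_apply,
      inner_self_eq_norm_sq]
  have hQ0 : ∀ x, 0 ≤ RCLike.re ⟪(1 - B) x, x⟫_𝕜 := fun x => by
    rw [hQq]
    exact sub_nonneg.2 (pow_le_pow_left₀ (norm_nonneg _) (hL x) 2)
  have hQe : ∀ i, hQ.eigenvalues hV i = 1 - hB.eigenvalues hV i.rev :=
    eigenvalues_const_sub hB hQ hV 1 fun x => by simp
  obtain ⟨R, hR, hRD⟩ := exists_sqrt hD hD0
  obtain ⟨S, hS, hSQ⟩ := exists_sqrt hQ hQ0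
  have hRDx : ∀ x, R (R x) = D x := fun x => by rw [← hRD]; rfl
  have hSQx : ∀ x, S (S x) = (1 - B) x := fun x => by rw [← hSQ]; rfl
  have hLB : ∀ x, L.adjoint (L x) = B x := fun x => by rw [hBL]; rfl
  have hQx : ∀ x, (1 - B) x = x - B x := fun x => by simp
  have hD1 : ((R ∘ₗ L.adjoint) ∘ₗ (L ∘ₗ R)).IsSymmetric := fun x y => by
    simp only [LinearMap.comp_apply]
    rw [hR, hLB, hB, hLB, hR]
  have hD2 : ((L ∘ₗ R) ∘ₗ (R ∘ₗ L.adjoint)).IsSymmetric := fun x y => by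
    simp only [LinearMap.comp_apply, hRDx]
    rw [← LinearMap.adjoint_inner_right, hD, LinearMap.adjoint_inner_left]
  have hE1 : ((R ∘ₗ S) ∘ₗ (S ∘ₗ R)).IsSymmetric := fun x y => by
    simp only [LinearMap.comp_apply]
    rw [hR, hS, hS, hR]
  have hE2 : ((S ∘ₗ R) ∘ₗ (R ∘ₗ S)).IsSymmetric := fun x y => by
    simp only [LinearMap.comp_apply]
    rw [hS, hR, hR, hS]
  have hE3 : (K.adjoint ∘ₗ F ∘ₗ K).IsSymmetric := fun x y => by
    simp only [LinearMap.comp_apply]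
    rw [LinearMap.adjoint_inner_left, hF, LinearMap.adjoint_inner_right]
  have hB' : (L ∘ₗ L.adjoint).IsSymmetric := fun x y => by
    simp only [LinearMap.comp_apply]
    rw [← LinearMap.adjoint_inner_right, LinearMap.adjoint_inner_left]
  have hK' : (1 - L ∘ₗ L.adjoint).IsSymmetric :=
    LinearMap.IsSymmetric.sub (LinearMap.IsSymmetric.id) hB'
  have hKq : ∀ y, ‖K y‖ ^ 2 ≤ RCLike.re ⟪(1 - L ∘ₗ L.adjoint) y, y⟫_𝕜 := fun y => by
    rw [LinearMap.sub_apply, inner_sub_left, map_sub, LinearMap.comp_apply, Module.End.one_apply,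
      ← LinearMap.adjoint_inner_right L, inner_self_eq_norm_sq, inner_self_eq_norm_sq]
    linarith [hLK y]
  -- `√D B √D` and `L D L*` have the same eigenvalues, and so do `√D (1 - B) √D` and `S D S`, with
  -- `S = √(1 - B)`; the multiplicative inequality applies to the form of `S D S`.
  have hD12 := eigenvalues_comp_comm hV hW (L ∘ₗ R) (R ∘ₗ L.adjoint) hD1 hD2
  have hE12 := eigenvalues_comp_comm hV hV (S ∘ₗ R) (R ∘ₗ S) hE1 hE2
  have hBB' : hB.eigenvalues hV = hB'.eigenvalues hW := by
    subst hBL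
    exact eigenvalues_comp_comm hV hW L L.adjoint hB hB'
  have hK'e : ∀ i, hK'.eigenvalues hW i = 1 - hB.eigenvalues hV i.rev := by
    rw [hBB']
    exact eigenvalues_const_sub hB' hK' hW 1 fun y => by simp
  have hstep1 : ∑ i ∈ J, (hD.eigenvalues hV i - hD1.eigenvalues hV i) ≤
      ∑ i : Fin n with i.val < J.card, hE1.eigenvalues hV i := by
    refine sum_eigenvalues_sub_le hD hD1 hE1 hV (fun x => le_of_eq ?_) J
    simp only [LinearMap.comp_apply]
    rw [← map_add, ← inner_add_left, ← map_add, hLB, hSQx, hQx, add_sub_cancel, hRDx]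
  have hstep2 : ∑ i ∈ J, (hD2.eigenvalues hW i - hT.eigenvalues hW i) ≤
      ∑ i : Fin n with i.val < J.card, hE3.eigenvalues hW i := by
    refine sum_eigenvalues_sub_le hD2 hT hE3 hW (fun y => ?_) J
    simp only [LinearMap.comp_apply]
    rw [hRDx, ← LinearMap.adjoint_inner_right, LinearMap.adjoint_inner_left]
    exact hTq y
  have hbound1 : ∑ i : Fin n with i.val < J.card, hE1.eigenvalues hV i ≤
      ∑ i : Fin n with i.val < J.card, hD.eigenvalues hV i * (1 - hB.eigenvalues hV i.rev) := by
    rw [hE12]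
    simp only [← hQe]
    refine sum_eigenvalues_le_sum_mul hQ hE2 hV (fun i => S (hD.eigenvectorBasis hV i))
      (fun z => ?_) (hD.eigenvalues_antitone hV) (eigenvalues_nonneg hD hV hD0) (fun z => ?_) hk
    · simp only [hS _ z]
      rw [OrthonormalBasis.sum_sq_norm_inner_right, ← hSQx, hS, inner_self_eq_norm_sq]
    · simp only [hS _ z, LinearMap.comp_apply]
      rw [hRDx, re_inner_apply_self hD hV]
  have hbound2 : ∑ i : Fin n with i.val < J.card, hE3.eigenvalues hW i ≤
      ∑ i : Fin n with i.val < J.card,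
        (if h : i.val < p then hF.eigenvalues hG ⟨i, h⟩ else 0) *
          (1 - hB.eigenvalues hV i.rev) := by
    simp only [← hK'e]
    have hpad : ∀ (f : Fin p → ℝ) (g : Fin n → ℝ), (∀ i : Fin p, g (Fin.castLE hp i) = f i) →
        (∀ i : Fin n, p ≤ i.val → g i = 0) → ∑ i, g i = ∑ i, f i := by
      intro f g h1 h2
      rw [← Finset.sum_congr rfl fun i _ => h1 i, sum_castLE_eq hp g, Finset.sum_filter]
      refine Finset.sum_congr rfl fun i _ => ?_
      split_ifs with h
      · rfl
      · exact h2 i (by omega)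
    refine sum_eigenvalues_le_sum_mul hK' hE3 hW
      (fun i => if h : i.val < p then K.adjoint (hF.eigenvectorBasis hG ⟨i, h⟩) else 0)
      (fun z => ?_) ?_ ?_ (fun z => ?_) hk
    · rw [hpad (fun i => ‖⟪hF.eigenvectorBasis hG i, K z⟫_𝕜‖ ^ 2),
        OrthonormalBasis.sum_sq_norm_inner_right]
      · exact hKq z
      · intro i
        simp [LinearMap.adjoint_inner_left]
      · intro i hi
        simp [not_lt.2 hi]
    · intro i j hij
      simp only
      have hij' : i.val ≤ j.val := hij
      split_ifs with h1 h2
      · exact hF.eigenvalues_antitone hG hij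
      · omega
      · exact eigenvalues_nonneg hF hG hF0 _
      · exact le_rfl
    · intro i
      split_ifs with h
      · exact eigenvalues_nonneg hF hG hF0 _
      · exact le_rfl
    · rw [hpad (fun i => hF.eigenvalues hG i * ‖⟪hF.eigenvectorBasis hG i, K z⟫_𝕜‖ ^ 2),
        LinearMap.comp_apply, LinearMap.comp_apply, LinearMap.adjoint_inner_left,
        re_inner_apply_self hF hG]
      · intro i
        simp [LinearMap.adjoint_inner_left]
      · intro i hi
        simp [not_lt.2 hi]
  simp only [add_mul, Finset.sum_add_distrib]
  calc ∑ i ∈ J, (hD.eigenvalues hV i - hT.eigenvalues hW i)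
      = ∑ i ∈ J, (hD.eigenvalues hV i - hD1.eigenvalues hV i) +
          ∑ i ∈ J, (hD2.eigenvalues hW i - hT.eigenvalues hW i) := by
        rw [← hD12, ← Finset.sum_add_distrib]
        exact Finset.sum_congr rfl fun i _ => by ring
    _ ≤ _ := add_le_add (hstep1.trans hbound1) (hstep2.trans hbound2)

end Operators

/-! ### Weak majorization -/

/-- The `k` largest entries of `y` have the largest sum among all choices of `k` entries. -/
theorem sum_le_sum_decreasing {n : ℕ} (y : Fin n → ℝ) (J : Finset (Fin n)) :
    ∑ i ∈ J, y i ≤ ∑ i : Fin n with i.val < J.card, decreasing y i := by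
  rcases J.eq_empty_or_nonempty with rfl | hJ
  · simp
  have hkn : J.card ≤ n := by simpa using J.card_le_univ
  let c := decreasing y ⟨J.card - 1, by have := hJ.card_pos; omega⟩
  calc ∑ i ∈ J, y i ≤ ∑ i ∈ J, (max (y i - c) 0 + c) :=
        Finset.sum_le_sum fun i _ => by linarith [le_max_left (y i - c) 0]
    _ = ∑ i ∈ J, max (y i - c) 0 + J.card * c := by
        rw [Finset.sum_add_distrib, Finset.sum_const, nsmul_eq_mul]
    _ ≤ ∑ i, max (y i - c) 0 + J.card * c := by
        gcongr
        exact J.subset_univ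
    _ = ∑ i, max (decreasing y i - c) 0 + J.card * c := by
        congr 1
        exact (Equiv.sum_comp (Tuple.sort fun i => -y i) fun i => max (y i - c) 0).symm
    _ = _ := sum_max_sub_add_eq hJ.card_pos hkn (decreasing_antitone y)

theorem weaklyMajorizedBy_of_forall_finset {n : ℕ} {x y : Fin n → ℝ}
    (h : ∀ J : Finset (Fin n), ∑ i ∈ J, x i ≤ ∑ i : Fin n with i.val < J.card, y i) :
    WeaklyMajorizedBy x y := by
  intro k hk
  let s : Finset (Fin n) := Finset.univ.filter fun i => i.val < k
  have hs : s.card = k := card_filter_val_lt hk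
  calc ∑ i ∈ s, decreasing x i
      = ∑ i ∈ s.map (Tuple.sort fun i => -x i).toEmbedding, x i := by
        rw [Finset.sum_map]; rfl
    _ ≤ ∑ i ∈ s, y i := by simpa [hs, s] using h (s.map (Tuple.sort fun i => -x i).toEmbedding)
    _ ≤ _ := by simpa [hs] using sum_le_sum_decreasing y s

section

variable {𝕜 E : Type*} [RCLike 𝕜] [NormedAddCommGroup E] [InnerProductSpace 𝕜 E]
  [FiniteDimensional 𝕜 E]

/-! ### Ritz values and interlacing -/

theorem inner_rayleighRitz_left (A : E →ₗ[𝕜] E) (X : Submodule 𝕜 E) (x y : X) :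
    ⟪rayleighRitz A X x, y⟫_𝕜 = ⟪A x, y⟫_𝕜 := by
  simp [rayleighRitz]

theorem ritzValues_le_ritzValues {A : E →ₗ[𝕜] E} (hA : A.IsSymmetric) {X Z : Submodule 𝕜 E}
    (hXZ : X ≤ Z) {n m : ℕ} (hX : finrank 𝕜 X = n) (hZ : finrank 𝕜 Z = m) (i : Fin n) (j : Fin m)
    (hij : i.val = j) : ritzValues hA X hX i ≤ ritzValues hA Z hZ j :=
  eigenvalues_le_eigenvalues _ hZ _ hX ⟨Submodule.inclusion hXZ, fun _ => rfl⟩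
    (fun x => by rw [inner_rayleighRitz_left, inner_rayleighRitz_left]; rfl) i j hij

theorem ritzValues_le_eigenvalues {A : E →ₗ[𝕜] E} (hA : A.IsSymmetric) (X : Submodule 𝕜 E)
    {n m : ℕ} (hX : finrank 𝕜 X = n) (hm : finrank 𝕜 E = m) (i : Fin n) (j : Fin m)
    (hij : i.val = j) : ritzValues hA X hX i ≤ hA.eigenvalues hm j :=
  eigenvalues_le_eigenvalues hA hm _ hX X.subtypeₗᵢ
    (fun x => by rw [inner_rayleighRitz_left]; rfl) i j hij

namespace IsInvariantForLargest

variable {A : E →ₗ[𝕜] E} {hA : A.IsSymmetric} {X : Submodule 𝕜 E}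

theorem apply_mem (h : IsInvariantForLargest hA X) {x : E} (hx : x ∈ X) : A x ∈ X :=
  h.1 x hx

theorem ritzValues_eq (h : IsInvariantForLargest hA X) {n : ℕ} (hX : finrank 𝕜 X = n)
    (i : Fin n) : ritzValues hA X hX i =
      hA.eigenvalues rfl (Fin.castLE (hX ▸ Submodule.finrank_le X) i) := by
  subst hX
  obtain ⟨hinv, h⟩ := h
  rw [← h, ritzValues]
  have : rayleighRitz A X = A.restrict hinv := by
    ext x
    simp only [rayleighRitz, LinearMap.comp_apply, Submodule.subtype_apply,
      ContinuousLinearMap.coe_coe, LinearMap.coe_restrict_apply]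
    exact congrArg Subtype.val
      (Submodule.orthogonalProjectionOnto_mem_subspace_eq_self ⟨A x, hinv x x.2⟩)
  congr 1

/-- On the orthogonal complement of `X` the form of `A` is at most the smallest Ritz value `λₙ` of `X`:
replacing the last eigenvector in `X` by a unit vector of `Xᗮ` gives an orthonormal family of `n`
vectors, whose Rayleigh quotients have sum at most `λ₁ + ⋯ + λₙ` by Ky Fan's principle. -/
theorem re_inner_le_of_mem_orthogonal (h : IsInvariantForLargest hA X) {m : ℕ}
    (hX : finrank 𝕜 X = m + 1) {z : E} (hz : z ∈ Xᗮ) :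
    RCLike.re ⟪A z, z⟫_𝕜 ≤ ritzValues hA X hX (Fin.last m) * ‖z‖ ^ 2 := by
  rcases eq_or_ne z 0 with rfl | hz0
  · simp
  have key : ∀ v ∈ Xᗮ, ‖v‖ = 1 → RCLike.re ⟪A v, v⟫_𝕜 ≤ ritzValues hA X hX (Fin.last m) := by
    intro v hv hv1
    let b := (rayleighRitz_isSymmetric hA X).eigenvectorBasis hX
    let u : Fin (m + 1) → E := Fin.snoc (fun i : Fin m => (b i.castSucc : E)) v
    have hu : Orthonormal 𝕜 u := by
      have hbb : ∀ i j, ⟪(b i : E), (b j : E)⟫_𝕜 = if i = j then 1 else 0 := fun i j =>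
        orthonormal_iff_ite.1 b.orthonormal i j
      rw [orthonormal_iff_ite]
      intro i j
      induction i using Fin.lastCases with
      | last =>
        induction j using Fin.lastCases with
        | last => simp [u, inner_self_eq_norm_sq_to_K, hv1]
        | cast j =>
          simp only [u, Fin.snoc_last, Fin.snoc_castSucc]
          rw [Submodule.inner_left_of_mem_orthogonal (b j.castSucc).2 hv,
            if_neg (Fin.castSucc_lt_last j).ne']
      | cast i =>
        induction j using Fin.lastCases with
        | last =>
          simp only [u, Fin.snoc_last, Fin.snoc_castSucc]
          rw [Submodule.inner_right_of_mem_orthogonal (b i.castSucc).2 hv,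
            if_neg (Fin.castSucc_lt_last i).ne]
        | cast j =>
          simp only [u, Fin.snoc_castSucc, hbb, Fin.castSucc_inj]
    have hb : ∀ i, RCLike.re ⟪A (b i : E), (b i : E)⟫_𝕜 = ritzValues hA X hX i := fun i => by
      rw [← inner_rayleighRitz_left, LinearMap.IsSymmetric.apply_eigenvectorBasis,
        inner_smul_left, RCLike.conj_ofReal, RCLike.re_ofReal_mul, inner_self_eq_norm_sq,
        OrthonormalBasis.norm_eq_one, one_pow, mul_one, ritzValues]
    have hKF := sum_inner_le_sum_eigenvalues hA rfl hu
    rw [← sum_castLE_eq (hX ▸ Submodule.finrank_le X)] at hKF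
    simp only [← h.ritzValues_eq hX] at hKF
    rw [Fin.sum_univ_castSucc, Fin.sum_univ_castSucc] at hKF
    simp only [u, Fin.snoc_last, Fin.snoc_castSucc, hb] at hKF
    linarith
  have hn : ‖z‖ ≠ 0 := norm_ne_zero_iff.2 hz0
  have := key ((‖z‖⁻¹ : 𝕜) • z) (Submodule.smul_mem _ _ hz) (by simp [norm_smul, hn])
  rw [map_smul, inner_smul_left, inner_smul_right, ← mul_assoc, map_inv₀, RCLike.conj_ofReal,
    ← RCLike.ofReal_inv, ← RCLike.ofReal_mul, RCLike.re_ofReal_mul] at this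
  have hp : 0 < ‖z‖ ^ 2 := by positivity
  rw [← mul_inv, ← sq, inv_mul_le_iff₀ hp] at this
  linarith

end IsInvariantForLargest

/-! ### Principal angles -/

theorem re_inner_starProjection_self (Y : Submodule 𝕜 E) (x : E) :
    RCLike.re ⟪Y.starProjection x, x⟫_𝕜 = ‖Y.starProjection x‖ ^ 2 := by
  rw [← inner_self_eq_norm_sq (𝕜 := 𝕜), ← Submodule.inner_starProjection_left_eq_right,
    Submodule.starProjection_eq_self_iff.2 (Y.starProjection_apply_mem x)]

theorem ritzValues_starProjection_le_one (X Y : Submodule 𝕜 E) {n : ℕ} (hX : finrank 𝕜 X = n)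
    (i : Fin n) :
    ritzValues (A := Y.starProjection.toLinearMap) Y.starProjection_isSymmetric X hX i ≤ 1 := by
  have h1 : (1 : X →ₗ[𝕜] X).IsSymmetric := LinearMap.IsSymmetric.id
  have h := eigenvalues_mono
    (rayleighRitz_isSymmetric (A := Y.starProjection.toLinearMap) Y.starProjection_isSymmetric X)
    h1 hX (fun x => ?_) i
  · rwa [eigenvalues_one] at h
  · rw [inner_rayleighRitz_left, Module.End.one_apply, inner_self_eq_norm_sq]
    exact (re_inner_starProjection_self Y (x : E)).trans_le
      (pow_le_pow_left₀ (norm_nonneg _) (Y.norm_starProjection_apply_le _) 2)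

/-- The intersection `X ⊓ Y` produces cosines equal to `1`, i.e. vanishing angles. -/
theorem ritzValues_starProjection_eq_one (X Y : Submodule 𝕜 E) {n : ℕ} (hX : finrank 𝕜 X = n)
    (i : Fin n) (hi : i.val < finrank 𝕜 ↥(X ⊓ Y)) :
    ritzValues (A := Y.starProjection.toLinearMap) Y.starProjection_isSymmetric X hX i = 1 := by
  refine le_antisymm (ritzValues_starProjection_le_one X Y hX i) ?_
  have h1 : (1 : ↥(X ⊓ Y) →ₗ[𝕜] ↥(X ⊓ Y)).IsSymmetric := LinearMap.IsSymmetric.id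
  have h := eigenvalues_le_eigenvalues
    (rayleighRitz_isSymmetric (A := Y.starProjection.toLinearMap) Y.starProjection_isSymmetric X)
    hX h1 rfl ⟨Submodule.inclusion inf_le_left, fun _ => rfl⟩ (fun x => ?_) ⟨i, hi⟩ i rfl
  · rwa [eigenvalues_one] at h
  · rw [inner_rayleighRitz_left, Module.End.one_apply]
    have : Y.starProjection (x : E) = x := Submodule.starProjection_eq_self_iff.2 x.2.2
    change _ ≤ RCLike.re ⟪Y.starProjection (x : E), (x : E)⟫_𝕜
    rw [this]
    rfl

theorem sin_principalAngles_sq (X Y : Submodule 𝕜 E) {n : ℕ} (hX : finrank 𝕜 X = n) (i : Fin n) :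
    Real.sin (principalAngles X Y hX i) ^ 2 = 1 - cosSqAngles X Y hX i := by
  have h0 : 0 ≤ cosSqAngles X Y hX i := eigenvalues_nonneg _ hX (fun x => by
    rw [inner_rayleighRitz_left]
    exact (sq_nonneg _).trans_eq (re_inner_starProjection_self Y (x : E)).symm) _
  have h1 : cosSqAngles X Y hX i ≤ 1 := ritzValues_starProjection_le_one X Y hX _
  rw [principalAngles, Real.sin_arccos, Real.sq_sqrt h0, Real.sq_sqrt (by linarith)]

/-- The map `L = P_Y|_X : X → Y`, whose adjoint is `P_X|_Y` and for which `L* L = (P_X P_Y)|_X`. It is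
kept behind an existential so that only these properties get unfolded. -/
theorem exists_projection_between (X Y : Submodule 𝕜 E) :
    ∃ L : X →ₗ[𝕜] Y, (∀ x, ‖L x‖ ≤ ‖x‖) ∧
      (∀ y, (L.adjoint y : E) = X.starProjection (y : E)) ∧
      rayleighRitz Y.starProjection.toLinearMap X = L.adjoint ∘ₗ L := by
  obtain ⟨L, hL⟩ : ∃ L : X →ₗ[𝕜] Y, ∀ x : X, L x = Y.orthogonalProjectionOnto (x : E) :=
    ⟨Y.orthogonalProjectionOnto.toLinearMap ∘ₗ X.subtype, fun _ => rfl⟩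
  have hadj : ∀ y, L.adjoint y = X.orthogonalProjectionOnto (y : E) := fun y => by
    refine ext_inner_right 𝕜 fun x => ?_
    rw [LinearMap.adjoint_inner_left]
    simp [hL]
  refine ⟨L, fun x => ?_, fun y => ?_,
    LinearMap.ext fun x => ?_⟩
  · rw [hL]
    exact Y.norm_orthogonalProjectionOnto_apply_le (x : E)
  · rw [hadj]
    rfl
  · rw [LinearMap.comp_apply, hadj, hL]
    rfl

/-- The orthogonal complement `G` of `X` in `X + Y`, and the map `y ↦ y - P_X y` from `Y` to `G`. -/
theorem exists_orthogonal_part (X Y : Submodule 𝕜 E) :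
    ∃ G : Submodule 𝕜 E, G ≤ Xᗮ ∧ G ≤ X ⊔ Y ∧
      finrank 𝕜 X + finrank 𝕜 G = finrank 𝕜 ↥(X ⊔ Y) ∧
      ∃ K : Y →ₗ[𝕜] G, ∀ y, (K y : E) = y - X.starProjection (y : E) :=
  ⟨Xᗮ ⊓ (X ⊔ Y), inf_le_left, inf_le_right,
    Submodule.finrank_add_inf_finrank_orthogonal le_sup_left,
    LinearMap.codRestrict _ (Y.subtype - X.starProjection.toLinearMap ∘ₗ Y.subtype) fun y =>
      ⟨Submodule.sub_starProjection_mem_orthogonal _,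
        Submodule.sub_mem _ (Submodule.mem_sup_right y.2)
          (Submodule.mem_sup_left (Submodule.starProjection_apply_mem _ _))⟩,
    fun _ => rfl⟩

/-- The partial-sum inequality behind both majorizations. With `μ = λₙ`, the operator inequality is
applied to `D = A|_X - μ`, to `T = (P_Y A)|_Y - μ`, and to `F = μ - (P_G A)|_G` on the orthogonal
complement `G` of `X` in `X + Y`. Interlacing bounds the eigenvalues of `F` by `μ - λ₋ᵢ`, and `μ`
cancels in the sum with the eigenvalues `λᵢ - μ` of `D`. -/
theorem sum_ritzValues_sub_le {A : E →ₗ[𝕜] E} (hA : A.IsSymmetric) {X Y : Submodule 𝕜 E} {n : ℕ}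
    (hX : finrank 𝕜 X = n) (hY : finrank 𝕜 Y = n) (hXA : IsInvariantForLargest hA X)
    (J : Finset (Fin n)) :
    ∑ i ∈ J, (ritzValues hA X hX i - ritzValues hA Y hY i) ≤
      ∑ i : Fin n with i.val < J.card,
        vectorSpread hA X Y hX i * Real.sin (principalAngles X Y hX i) ^ 2 := by
  -- For `n = 0` there is no smallest Ritz value of `X`, but both sums are empty.
  obtain _ | m := n
  · simp [Finset.eq_empty_of_isEmpty J]
  obtain ⟨μ, hμ⟩ : ∃ μ : ℝ, μ = ritzValues hA X hX (Fin.last m) := ⟨_, rfl⟩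
  obtain ⟨G, hGX, hGH, hGdim, K, hK⟩ := exists_orthogonal_part X Y
  have hinf := Submodule.finrank_sup_add_finrank_inf_eq X Y
  have hμsymm : ∀ Z : Submodule 𝕜 E, ((μ : 𝕜) • (1 : Z →ₗ[𝕜] Z)).IsSymmetric := fun Z =>
    LinearMap.IsSymmetric.id.smul (RCLike.conj_ofReal μ)
  have hD := (rayleighRitz_isSymmetric hA X).sub (hμsymm X)
  have hT := (rayleighRitz_isSymmetric hA Y).sub (hμsymm Y)
  have hF := (hμsymm G).sub (rayleighRitz_isSymmetric hA G)
  have hH := (hμsymm (X ⊔ Y)).sub (rayleighRitz_isSymmetric hA (X ⊔ Y))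
  have hDq : ∀ (Z : Submodule 𝕜 E) (z : Z),
      RCLike.re ⟪(rayleighRitz A Z - (μ : 𝕜) • 1) z, z⟫_𝕜 =
        RCLike.re ⟪A z, z⟫_𝕜 - μ * ‖(z : E)‖ ^ 2 := fun Z z => by
    rw [LinearMap.sub_apply, inner_sub_left, map_sub, inner_rayleighRitz_left,
      LinearMap.smul_apply, inner_smul_left, Module.End.one_apply, RCLike.conj_ofReal,
      RCLike.re_ofReal_mul, inner_self_eq_norm_sq, Submodule.coe_norm]
  have hFq : ∀ (Z : Submodule 𝕜 E) (z : Z),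
      RCLike.re ⟪((μ : 𝕜) • 1 - rayleighRitz A Z) z, z⟫_𝕜 =
        μ * ‖(z : E)‖ ^ 2 - RCLike.re ⟪A z, z⟫_𝕜 := fun Z z => by
    rw [← neg_sub, LinearMap.neg_apply, inner_neg_left, map_neg, hDq, neg_sub]
  have hDe : ∀ i, hD.eigenvalues hX i = ritzValues hA X hX i - μ :=
    eigenvalues_sub_const _ hD hX μ fun x => rfl
  have hTe : ∀ i, hT.eigenvalues hY i = ritzValues hA Y hY i - μ :=
    eigenvalues_sub_const _ hT hY μ fun x => rfl
  have hHe : ∀ i, hH.eigenvalues rfl i = μ - ritzValues hA (X ⊔ Y) rfl i.rev :=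
    eigenvalues_const_sub _ hH rfl μ fun x => rfl
  have hFH : ∀ (i : Fin (finrank 𝕜 G)) (j : Fin (finrank 𝕜 ↥(X ⊔ Y))), i.val = j →
      hF.eigenvalues rfl i ≤ μ - ritzValues hA (X ⊔ Y) rfl j.rev := fun i j hij => by
    rw [← hHe]
    exact eigenvalues_le_eigenvalues hH rfl hF rfl
      ⟨Submodule.inclusion hGH, fun _ => rfl⟩
      (fun x => by rw [hFq, hFq]; rfl) i j hij
  have hD0 : ∀ x : X, 0 ≤ RCLike.re ⟪(rayleighRitz A X - (μ : 𝕜) • 1) x, x⟫_𝕜 := fun x => by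
    rw [re_inner_apply_self hD hX]
    refine Finset.sum_nonneg fun i _ => mul_nonneg ?_ (by positivity)
    rw [hDe, hμ]
    exact sub_nonneg.2 ((rayleighRitz_isSymmetric hA X).eigenvalues_antitone hX (Fin.le_last i))
  have hF0 : ∀ z : G, 0 ≤ RCLike.re ⟪((μ : 𝕜) • 1 - rayleighRitz A G) z, z⟫_𝕜 := fun z => by
    rw [hFq, hμ]
    exact sub_nonneg.2 (hXA.re_inner_le_of_mem_orthogonal hX (hGX z.2))
  obtain ⟨L, hL, hLadj, hBL⟩ := exists_projection_between X Y
  have hB := rayleighRitz_isSymmetric (A := Y.starProjection.toLinearMap)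
    Y.starProjection_isSymmetric X
  have hsplit : ∀ y : Y, (y : E) = L.adjoint y + K y := fun y => by
    rw [hLadj, hK, add_sub_cancel]
  have hpyth : ∀ y : Y, ‖(y : E)‖ ^ 2 = ‖(L.adjoint y : E)‖ ^ 2 + ‖(K y : E)‖ ^ 2 := fun y => by
    conv_lhs => rw [hsplit y]
    rw [sq, norm_add_sq_eq_norm_sq_add_norm_sq_of_inner_eq_zero _ _
      (Submodule.inner_right_of_mem_orthogonal (L.adjoint y).2 (hGX (K y).2)), ← sq, ← sq]
  have hcore := sum_eigenvalues_sub_le_sum_mul hX hY rfl (by omega) L K hD hD0 hT hF hF0 hB hBL hL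
    (fun y => (hpyth y).ge)
    (fun y => by
      rw [hDq, hDq, hFq, hpyth]
      -- By invariance of `X` there are no cross terms, so the form of `A` splits along `X` and `G`.
      have h1 : ⟪A (L.adjoint y : E), (K y : E)⟫_𝕜 = 0 :=
        Submodule.inner_right_of_mem_orthogonal (hXA.apply_mem (L.adjoint y).2) (hGX (K y).2)
      have h2 : ⟪A (K y : E), (L.adjoint y : E)⟫_𝕜 = 0 := by
        rw [hA]
        exact Submodule.inner_left_of_mem_orthogonal (hXA.apply_mem (L.adjoint y).2) (hGX (K y).2)
      have h3 : RCLike.re ⟪A (y : E), (y : E)⟫_𝕜 =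
          RCLike.re ⟪A (L.adjoint y : E), (L.adjoint y : E)⟫_𝕜 +
            RCLike.re ⟪A (K y : E), (K y : E)⟫_𝕜 := by
        conv_lhs => rw [hsplit y]
        rw [map_add, inner_add_left, inner_add_right, inner_add_right, h1, h2]
        simp
      rw [h3]
      apply le_of_eq
      ring) J
  have hle : ∑ i ∈ J, (ritzValues hA X hX i - ritzValues hA Y hY i) =
      ∑ i ∈ J, (hD.eigenvalues hX i - hT.eigenvalues hY i) :=
    Finset.sum_congr rfl fun i _ => by rw [hDe, hTe]; ring
  rw [hle]
  refine hcore.trans (Finset.sum_le_sum fun i _ => ?_)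
  rw [sin_principalAngles_sq]
  change (_ + _) * (1 - cosSqAngles X Y hX i) ≤ _
  split_ifs with hi
  · refine mul_le_mul_of_nonneg_right ?_
      (sub_nonneg.2 (ritzValues_starProjection_le_one X Y hX _))
    have hXH : m + 1 ≤ finrank 𝕜 ↥(X ⊔ Y) := by omega
    have h1 := hFH ⟨i, hi⟩ (Fin.castLE hXH i) rfl
    have h2 := ritzValues_le_ritzValues hA (le_sup_left : X ≤ X ⊔ Y) hX rfl i
      (Fin.castLE hXH i) rfl
    rw [hDe]
    simp only [vectorSpread]
    linarith
  -- Beyond `dim G` the eigenvalues of `F` are padded by zeros and the spread may be negative, but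
  -- the angle vanishes because `dim (X ⊓ Y) = n - dim G`.
  · have : cosSqAngles X Y hX i = 1 :=
      ritzValues_starProjection_eq_one X Y hX i.rev (by rw [Fin.val_rev]; omega)
    rw [this]
    simp

end

end RayleighRitz

theorem theorem2p3 {𝕜 E : Type*} [RCLike 𝕜] [NormedAddCommGroup E] [InnerProductSpace 𝕜 E]
    [FiniteDimensional 𝕜 E] (A : E →ₗ[𝕜] E) (hA : A.IsSymmetric) (X Y : Submodule 𝕜 E) (n : ℕ)
    (hX : Module.finrank 𝕜 X = n) (hY : Module.finrank 𝕜 Y = n)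
    (hXA : RayleighRitz.IsInvariantForLargest hA X) :
    RayleighRitz.WeaklyMajorizedBy
        (fun i => |RayleighRitz.ritzValues hA X hX i - RayleighRitz.ritzValues hA Y hY i|)
        (fun i => RayleighRitz.vectorSpread hA X Y hX i *
          Real.sin (RayleighRitz.principalAngles X Y hX i) ^ 2) ∧
      (∀ i, RayleighRitz.vectorSpread hA X Y hX i ≤
          RayleighRitz.ritzValues hA X hX i - RayleighRitz.ritzMin hA (X ⊔ Y)) ∧
      (∀ i, 0 ≤ RayleighRitz.ritzValues hA X hX i - RayleighRitz.ritzValues hA Y hY i) ∧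
      RayleighRitz.WeaklyMajorizedBy
        (fun i => RayleighRitz.ritzValues hA X hX i - RayleighRitz.ritzValues hA Y hY i)
        (fun i => (RayleighRitz.ritzValues hA X hX i - RayleighRitz.ritzMin hA (X ⊔ Y)) *
          Real.sin (RayleighRitz.principalAngles X Y hX i) ^ 2) := by
  have hnonneg : ∀ i, 0 ≤ RayleighRitz.ritzValues hA X hX i -
      RayleighRitz.ritzValues hA Y hY i := fun i => by
    rw [hXA.ritzValues_eq hX i]
    exact sub_nonneg.2 (RayleighRitz.ritzValues_le_eigenvalues hA Y hY rfl _ _ rfl)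
  have hspread : ∀ i, RayleighRitz.vectorSpread hA X Y hX i ≤
      RayleighRitz.ritzValues hA X hX i - RayleighRitz.ritzMin hA (X ⊔ Y) := fun i => by
    rw [hXA.ritzValues_eq hX i]
    exact sub_le_sub (RayleighRitz.ritzValues_le_eigenvalues hA (X ⊔ Y) rfl rfl _ _ rfl)
      (ciInf_le (Set.finite_range _).bddBelow _)
  refine ⟨?_, hspread, hnonneg, ?_⟩
  · simp only [abs_of_nonneg (hnonneg _)]
    exact RayleighRitz.weaklyMajorizedBy_of_forall_finset
      (RayleighRitz.sum_ritzValues_sub_le hA hX hY hXA)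
  · refine RayleighRitz.weaklyMajorizedBy_of_forall_finset fun J =>
      (RayleighRitz.sum_ritzValues_sub_le hA hX hY hXA J).trans
        (Finset.sum_le_sum fun i _ => ?_)
    exact mul_le_mul_of_nonneg_right (hspread i) (sq_nonneg _)
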